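/- Logarithms are to base $2$ and graphs are finite and simple. For graphs $G,H$ let $G\boxtimes H$ be the strong product (distinct pairs are adjacent iff in each coordinate they are equal or adjacent), $G^{\boxtimes n}$ the $n$-fold strong power, with vertex set $V(G)^n$, and $G[S]$ the subgraph induced by $S\subseteq V(G)$. A spectral point is a function $f$ from graphs to $\mathbb{R}_{\ge 0}$ with $f(G\sqcup H)=f(G)+f(H)$, $f(G\boxtimes H)=f(G)f(H)$, $f(\overline{K_d})=d$, and $f(H)\le f(G)$ whenever there is a graph homomorphism $\overline{H}\to\overline{G}$. For a probability distribution $P$ on $V(G)$ put $$F(G,P)=\lim_{n\to\infty}\frac1n\log f\bigl(G^{\boxtimes n}[T^n_{P^{(n)}}]\bigr),$$ where $P^{(n)}$ is any sequence of $n$-types on $V(G)$ (distributions with values in $\frac1n\mathbb{Z}$) converging to $P$, and $T^n_{Q}\subseteq V(G)^n$ is the set of strings with empirical distribution $Q$. (1) Let $G$ be a graph, $f$ a spectral point and $P$ a probability distribution on $V(G)$. Then the limit $F(G,P)$ exists and does not depend on the choice of the sequence $P^{(n)}$, and for every nonempty $S\subseteq V(G)$ $$\log f(G[S])\ \ge\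 F(G,P)-(1-P(S))\log|V(G)|-1 .$$ (2) Let $G$ be a graph and $\mu$ a probability measure on $V(G)^\infty$ (with the product of the discrete $\sigma$-algebras), with marginals $\mu_{1\ldots n}$ on $V(G)^n$. Suppose that $(G,\mu)$ has the asymptotic equipartition property, i.e. for every spectral point $f$ the limit $$\lim_{n\to\infty}\ \min_{\substack{S\subseteq V(G)^n\\ \mu_{1\ldots n}(S)\ge c}}\frac1n\log f(G^{\boxtimes n}[S])$$ exists and is the same for all $c\in(0,1)$. Then for every spectral point $f$ this common limit is at least $$\limsup_{n\to\infty}\frac1n F(G^{\boxtimes n},\mu_{1\ldots n}).$$ -/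

import Mathlib

open Filter Topology MeasureTheory

universe u

namespace AmbiguousAEP

/-- The strong product `G ⊠ H`: distinct pairs are adjacent iff in each coordinate they are
adjacent or equal. -/
def strongProd {V W : Type u} (G : SimpleGraph V) (H : SimpleGraph W) :
    SimpleGraph (V × W) where
  Adj x y := x ≠ y ∧ (x.1 = y.1 ∨ G.Adj x.1 y.1) ∧ (x.2 = y.2 ∨ H.Adj x.2 y.2)
  symm := ⟨fun _ _ h => ⟨h.1.symm,
    h.2.1.imp Eq.symm (fun h => G.adj_symm h), h.2.2.imp Eq.symm (fun h => H.adj_symm h)⟩⟩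
  loopless := ⟨fun _ h => h.1 rfl⟩

/-- The `n`-fold strong power `G^{⊠n}` on strings of length `n`: distinct strings are adjacent iff
in every coordinate they are adjacent or equal. -/
def strongPow {V : Type u} (G : SimpleGraph V) (n : ℕ) : SimpleGraph (Fin n → V) where
  Adj x y := x ≠ y ∧ ∀ i, x i = y i ∨ G.Adj (x i) (y i)
  symm := ⟨fun _ _ h => ⟨h.1.symm, fun i => (h.2 i).imp Eq.symm (fun h => G.adj_symm h)⟩⟩
  loopless := ⟨fun _ h => h.1 rfl⟩

/-- An element of the asymptotic spectrum of (finite simple) graphs. The order `H ≤ G` on graphs is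
the existence of a homomorphism `Hᶜ → Gᶜ`; the edgeless graph `⊥` on `d` vertices is the complement
of the complete graph on `d` vertices. -/
structure SpectralPoint where
  toFun : (V : Type u) → [Finite V] → SimpleGraph V → ℝ
  nonneg : ∀ (V : Type u) [Finite V] (G : SimpleGraph V), 0 ≤ toFun V G
  map_sum : ∀ (V W : Type u) [Finite V] [Finite W] (G : SimpleGraph V) (H : SimpleGraph W),
    toFun (V ⊕ W) (G.sum H) = toFun V G + toFun W H
  map_strongProd : ∀ (V W : Type u) [Finite V] [Finite W] (G : SimpleGraph V) (H : SimpleGraph W),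
    toFun (V × W) (strongProd G H) = toFun V G * toFun W H
  mono : ∀ (V W : Type u) [Finite V] [Finite W] (G : SimpleGraph V) (H : SimpleGraph W),
    Nonempty (Hᶜ →g Gᶜ) → toFun W H ≤ toFun V G
  map_edgeless : ∀ (V : Type u) [Finite V], toFun V (⊥ : SimpleGraph V) = Nat.card V

/-- `log₂ f(G[S])`, for the subgraph `G[S]` of `G` induced by `S`. -/
noncomputable def logInduced {V : Type u} [Finite V] (f : SpectralPoint.{u}) (G : SimpleGraph V)
    (S : Set V) : ℝ :=
  Real.logb 2 (f.toFun S (G.induce S))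

/-- The type class of strings of length `n` in which each letter `v` occurs exactly `t v` times. -/
def typeClass {V : Type u} (n : ℕ) (t : V → ℕ) : Set (Fin n → V) :=
  {x | ∀ v, Nat.card {i // x i = v} = t v}

/-- `L` is the value at `(G, P)` of the logarithmic probabilistic refinement of `f`: for every
sequence of `n`-types `P⁽ⁿ⁾ = t n / n` converging to `P`, the numbers
`(1 / n) log₂ f(G^{⊠n}[T])`, with `T` the type class of `P⁽ⁿ⁾`, converge to `L`. -/
def IsLogRefinement {V : Type u} [Fintype V] (f : SpectralPoint.{u}) (G : SimpleGraph V)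
    (P : V → ℝ) (L : ℝ) : Prop :=
  ∀ t : ℕ → V → ℕ, (∀ n, ∑ v, t n v = n) →
    (∀ v, Tendsto (fun n : ℕ => (t n v : ℝ) / n) atTop (𝓝 (P v))) →
    Tendsto (fun n : ℕ => logInduced f (strongPow G n) (typeClass n (t n)) / n) atTop (𝓝 L)

open Classical in
/-- The logarithmic probabilistic refinement `F(G, P)` of `f`. -/
noncomputable def logRefinement {V : Type u} [Fintype V] (f : SpectralPoint.{u})
    (G : SimpleGraph V) (P : V → ℝ) : ℝ :=
  if h : ∃ L, IsLogRefinement f G P L then h.choose else 0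

/-- The joint distribution `μ_{12…n}` of the first `n` letters. -/
noncomputable def marginal {V : Type u} [MeasurableSpace V] (μ : Measure (ℕ → V)) (n : ℕ) :
    Measure (Fin n → V) :=
  μ.map (fun ω i => ω i)

/-- The minimum of `(1 / n) log₂ f(G^{⊠n}[S])` over the sets `S ⊆ V(G)ⁿ` with
`μ_{12…n}(S) ≥ c`. -/
noncomputable def minRate {V : Type u} [Finite V] [MeasurableSpace V] (f : SpectralPoint.{u})
    (G : SimpleGraph V) (μ : Measure (ℕ → V)) (c : ℝ) (n : ℕ) : ℝ :=
  sInf ((fun S : Set (Fin n → V) => logInduced f (strongPow G n) S / n) ''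
    {S | c ≤ (marginal μ n).real S})

/-- `L` is the common limit, for all `c ∈ (0, 1)`, of the minimal rates. -/
def IsCommonLimit {V : Type u} [Finite V] [MeasurableSpace V] (f : SpectralPoint.{u})
    (G : SimpleGraph V) (μ : Measure (ℕ → V)) (L : ℝ) : Prop :=
  ∀ c ∈ Set.Ioo (0 : ℝ) 1, Tendsto (minRate f G μ c) atTop (𝓝 L)

/-- The asymptotic equipartition property of the pair `(G, μ)`. -/
def HasAEP {V : Type u} [Finite V] [MeasurableSpace V] (G : SimpleGraph V)
    (μ : Measure (ℕ → V)) : Prop :=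
  ∀ f : SpectralPoint.{u}, ∃ L : ℝ, IsCommonLimit f G μ L

end AmbiguousAEP

/-! Part (1) combines two facts about type classes. Concatenation embeds a product of type classes
in the class of the summed type, so log f is superadditive (`logInduced_typeClass_add`). Changing j
letter counts costs at most a binomial factor times |V|^j (`typeClass_add_le`), so the rates are
equicontinuous in the type. Repeating a good type at length m, padding, and correcting the counts
shows that its rate is nearly reached at all large n, along any sequence of types with the same
limit (`eventually_rate_ge`); hence the limit exists and is unique. For the inequality, guess which
positions of a string carry letters of S: there are at most 2^n guesses, and each gives a box
bounded by f(G[S])^k |V|^(n-k) with k/n → P(S) (`typeClass_le_pow_induce`). Part (2) applies (1) to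
G^{⊠n} with the n-th marginal. As log |V^n| = n log |V|, the error per letter is (1-c) log |V| +
1/n; let n → ∞, then c → 1. -/

namespace AmbiguousAEP

/-- The reflexive closure of adjacency. -/
def AdjOrEq {V : Type u} (G : SimpleGraph V) (x y : V) : Prop := x = y ∨ G.Adj x y

theorem adjOrEq_strongProd {V W : Type u} {G : SimpleGraph V} {H : SimpleGraph W} {x y : V × W} :
    AdjOrEq (strongProd G H) x y ↔ AdjOrEq G x.1 y.1 ∧ AdjOrEq H x.2 y.2 := by
  by_cases h : x = y
  · subst h; simp [AdjOrEq]
  · simp [AdjOrEq, strongProd, h]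

theorem adjOrEq_strongPow {V : Type u} {G : SimpleGraph V} {n : ℕ} {x y : Fin n → V} :
    AdjOrEq (strongPow G n) x y ↔ ∀ i, AdjOrEq G (x i) (y i) := by
  by_cases h : x = y
  · subst h; simp [AdjOrEq]
  · simp [AdjOrEq, strongPow, h]

theorem adjOrEq_induce {V : Type u} {G : SimpleGraph V} {S : Set V} {x y : S} :
    AdjOrEq (G.induce S) x y ↔ AdjOrEq G (x : V) y := by
  simp [AdjOrEq, Subtype.ext_iff]

theorem adjOrEq_bot {V : Type u} {x y : V} : AdjOrEq (⊥ : SimpleGraph V) x y ↔ x = y := by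
  simp [AdjOrEq]

/-! ### Monotonicity, subadditivity and products for spectral points. -/

namespace SpectralPoint

variable (f : SpectralPoint.{u})

/-- Contrapositive form of a homomorphism of complements: such a map preserves being distinct and
non-adjacent, that is, it reflects `AdjOrEq`. -/
theorem mono_map {V W : Type u} [Finite V] [Finite W] {G : SimpleGraph V} {H : SimpleGraph W}
    (φ : W → V) (h : ∀ x y, AdjOrEq G (φ x) (φ y) → AdjOrEq H x y) :
    f.toFun W H ≤ f.toFun V G := by
  refine f.mono V W G H ⟨⟨φ, ?_⟩⟩
  intro x y hxy
  rw [SimpleGraph.compl_adj] at hxy ⊢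
  have := mt (h x y)
  simp only [AdjOrEq, not_or] at this
  exact this hxy

theorem le_card {V : Type u} [Finite V] (G : SimpleGraph V) : f.toFun V G ≤ Nat.card V := by
  rw [← f.map_edgeless]
  exact f.mono_map id fun x y h => Or.inl (adjOrEq_bot.1 h)

theorem one_le {V : Type u} [Finite V] [Nonempty V] (G : SimpleGraph V) : 1 ≤ f.toFun V G := by
  have h : f.toFun PUnit.{u + 1} ⊥ = 1 := by rw [f.map_edgeless]; simp
  rw [← h]
  exact f.mono_map (fun _ => Classical.arbitrary V) fun x y _ => Or.inl rfl

theorem induce_mono {V : Type u} [Finite V] (G : SimpleGraph V) {S T : Set V} (h : S ⊆ T) :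
    f.toFun S (G.induce S) ≤ f.toFun T (G.induce T) :=
  f.mono_map (Set.inclusion h) fun x y hxy => by
    rw [adjOrEq_induce] at hxy ⊢
    exact hxy

theorem induce_empty {V : Type u} [Finite V] (G : SimpleGraph V) :
    f.toFun (∅ : Set V) (G.induce ∅) = 0 := by
  refine le_antisymm ((f.le_card _).trans ?_) (f.nonneg _ _)
  simp

theorem induce_union_le {V : Type u} [Finite V] (G : SimpleGraph V) (S T : Set V) :
    f.toFun (S ∪ T : Set V) (G.induce (S ∪ T)) ≤
      f.toFun S (G.induce S) + f.toFun T (G.induce T) := by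
  classical
  rw [← f.map_sum]
  refine f.mono_map (fun x => if h : (x : V) ∈ S then Sum.inl ⟨x, h⟩
    else Sum.inr ⟨x, x.2.resolve_left h⟩) ?_
  intro x y h
  by_cases hx : (x : V) ∈ S <;> by_cases hy : (y : V) ∈ S <;>
    simp_all [AdjOrEq, Subtype.ext_iff]

theorem induce_biUnion_le {V : Type u} [Finite V] (G : SimpleGraph V) {ι : Type*}
    (s : Finset ι) (A : ι → Set V) {B : Set V} (hB : ∀ x ∈ B, ∃ i ∈ s, x ∈ A i) :
    f.toFun B (G.induce B) ≤ ∑ i ∈ s, f.toFun (A i) (G.induce (A i)) := by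
  classical
  induction s using Finset.induction_on generalizing B with
  | empty =>
    have : B = ∅ := by
      ext x; constructor
      · intro h; obtain ⟨i, hi, -⟩ := hB x h; simp at hi
      · simp
    subst this
    simp [f.induce_empty G]
  | insert i s hi ih =>
    rw [Finset.sum_insert hi]
    refine (f.induce_mono G (T := A i ∪ (B \ A i)) (by intro x; simp; tauto)).trans
      ((f.induce_union_le G _ _).trans (add_le_add le_rfl (ih ?_)))
    rintro x ⟨hx, hxi⟩
    obtain ⟨k, hk, hxk⟩ := hB x hx
    rcases Finset.mem_insert.1 hk with rfl | hk
    · exact absurd hxk hxi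
    · exact ⟨k, hk, hxk⟩

theorem induce_pi_le {V : Type u} [Finite V] (G : SimpleGraph V) (n : ℕ) (A : Fin n → Set V) :
    f.toFun {x : Fin n → V | ∀ i, x i ∈ A i} ((strongPow G n).induce {x | ∀ i, x i ∈ A i}) ≤
      ∏ i, f.toFun (A i) (G.induce (A i)) := by
  induction n with
  | zero =>
    refine (f.le_card _).trans ?_
    simp
  | succ n ih =>
    rw [Fin.prod_univ_succ]
    refine le_trans ?_ (mul_le_mul_of_nonneg_left (ih fun i => A i.succ) (f.nonneg _ _))
    rw [← f.map_strongProd]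
    refine f.mono_map (fun x => (⟨x.1 0, x.2 0⟩, ⟨fun i => x.1 i.succ, fun i => x.2 i.succ⟩)) ?_
    intro x y h
    simp only [adjOrEq_strongProd, adjOrEq_induce, adjOrEq_strongPow] at h ⊢
    exact Fin.cases h.1 h.2

theorem induce_pow_le_mul {V : Type u} [Finite V] (G : SimpleGraph V) {m n k : ℕ}
    {S : Set (Fin m → V)} {T : Set (Fin n → V)} {U : Set (Fin k → V)} (hk : m + n = k)
    (h : ∀ x ∈ S, ∀ y ∈ T, Fin.append x y ∘ Fin.cast hk.symm ∈ U) :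
    f.toFun S ((strongPow G m).induce S) * f.toFun T ((strongPow G n).induce T) ≤
      f.toFun U ((strongPow G k).induce U) := by
  subst hk
  rw [← f.map_strongProd]
  refine f.mono_map (fun z => ⟨Fin.append z.1.1 z.2.1, h _ z.1.2 _ z.2.2⟩) ?_
  intro x y h
  simp only [adjOrEq_strongProd, adjOrEq_induce, adjOrEq_strongPow] at h ⊢
  exact ⟨fun i => by simpa using h (Fin.castAdd n i), fun i => by simpa using h (Fin.natAdd m i)⟩

end SpectralPoint

/-! ### Combinatorics of type classes. -/

section TypeClass

variable {V : Type u} {n m : ℕ}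

theorem mem_typeClass [DecidableEq V] {t : V → ℕ} {x : Fin n → V} :
    x ∈ typeClass n t ↔ ∀ v, (Finset.univ.filter fun i => x i = v).card = t v := by
  simp [typeClass, Fintype.card_subtype]

theorem append_mem_typeClass {s t : V → ℕ} {k : ℕ} (hk : m + n = k) {x : Fin m → V} {y : Fin n → V}
    (hx : x ∈ typeClass m s) (hy : y ∈ typeClass n t) :
    Fin.append x y ∘ Fin.cast hk.symm ∈ typeClass k (s + t) := by
  classical
  subst hk
  rw [mem_typeClass] at *
  intro v
  have h := Fin.sum_univ_add (fun i => if Fin.append x y i = v then 1 else 0)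
  simp only [Fin.append_left, Fin.append_right, Finset.sum_boole, Nat.cast_id] at h
  simpa [hx v, hy v] using h

theorem typeClass_nonempty [Fintype V] {t : V → ℕ} (h : ∑ v, t v = n) :
    (typeClass n t).Nonempty := by
  classical
  have hc : Fintype.card (Σ v, Fin (t v)) = Fintype.card (Fin n) := by simp [h]
  let e := Fintype.equivOfCardEq hc
  refine ⟨fun i => (e.symm i).1, ?_⟩
  intro v
  rw [← Nat.card_fin (t v)]
  refine Nat.card_congr ?_
  refine (e.symm.subtypeEquiv (q := fun p => p.1 = v) (fun _ => Iff.rfl)).trans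
    (Equiv.sigmaSubtype v)

end TypeClass

/-- Discard `d v` of the positions carrying each letter `v`; what is left, read in increasing order,
has type `s`. -/
theorem exists_subset_comp_mem_typeClass {V : Type u} [Fintype V] {m n : ℕ} {s d : V → ℕ}
    {x : Fin n → V} (hx : x ∈ typeClass n (s + d)) :
    ∃ J : Finset (Fin n), J.card = ∑ v, d v ∧
      ∀ h : Jᶜ.card = m, x ∘ Jᶜ.orderEmbOfFin h ∈ typeClass m s := by
  classical
  rw [mem_typeClass] at hx
  have hsub : ∀ v, ∃ K ⊆ Finset.univ.filter (fun i => x i = v), K.card = d v := fun v =>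
    Finset.exists_subset_card_eq (by rw [hx v]; exact Nat.le_add_left _ _)
  choose K hK hKc using hsub
  set J : Finset (Fin n) := Finset.univ.filter fun i => i ∈ K (x i) with hJ
  have hfib : ∀ v, J.filter (fun i => x i = v) = K v := by
    intro v
    ext i
    simp only [hJ, Finset.mem_filter, Finset.mem_univ, true_and]
    constructor
    · rintro ⟨h, rfl⟩; exact h
    · intro h
      have : x i = v := by simpa using hK v h
      exact ⟨this ▸ h, this⟩
  refine ⟨J, ?_, ?_⟩
  · rw [Finset.card_eq_sum_card_fiberwise (f := x) (t := Finset.univ) (by simp)]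
    simp [hfib, hKc]
  · intro h
    rw [mem_typeClass]
    intro v
    have h1 : (Finset.univ.filter fun k => (x ∘ Jᶜ.orderEmbOfFin h) k = v).map
        (Jᶜ.orderEmbOfFin h).toEmbedding = (Finset.univ.filter fun i => x i = v) \ K v := by
      ext i
      simp only [Finset.mem_map, Finset.mem_filter, Finset.mem_univ, true_and, Finset.mem_sdiff,
        Function.comp_apply, RelEmbedding.coe_toEmbedding]
      constructor
      · rintro ⟨k, hk, rfl⟩
        refine ⟨hk, fun hmem => ?_⟩
        have := Finset.orderEmbOfFin_mem Jᶜ h k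
        rw [Finset.mem_compl] at this
        rw [← hfib, Finset.mem_filter] at hmem
        exact this hmem.1
      · rintro ⟨hi, hiK⟩
        have hiJ : i ∈ Set.range (Jᶜ.orderEmbOfFin h) := by
          rw [Finset.range_orderEmbOfFin]
          simpa [hJ, hi] using hiK
        obtain ⟨k, rfl⟩ := hiJ
        exact ⟨k, hi, rfl⟩
    rw [← Finset.card_map, h1, Finset.card_sdiff_of_subset (hK v), hx v, hKc v]
    simp

/-! ### Covering bounds for type classes. -/

namespace SpectralPoint

variable (f : SpectralPoint.{u}) {V : Type u} [Fintype V] (G : SimpleGraph V)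

/-- Union bound over the set `J` of discarded positions. The letters on `J` are recorded exactly in
an edgeless graph, which gives the power of |V|. -/
theorem typeClass_add_le {m n : ℕ} {s d : V → ℕ} (hm : ∑ v, s v = m)
    (hn : m + ∑ v, d v = n) :
    f.toFun (typeClass n (s + d)) ((strongPow G n).induce (typeClass n (s + d))) ≤
      n.choose (∑ v, d v) * ((Fintype.card V : ℝ) ^ (∑ v, d v) *
        f.toFun (typeClass m s) ((strongPow G m).induce (typeClass m s))) := by
  classical
  set j := ∑ v, d v with hj
  have key := f.induce_biUnion_le (strongPow G n) ((Finset.univ : Finset (Fin n)).powersetCard j)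
    (fun J => {x | ∀ h : Jᶜ.card = m, x ∘ Jᶜ.orderEmbOfFin h ∈ typeClass m s})
    (B := typeClass n (s + d)) (by
      intro x hx
      obtain ⟨J, hJ, h⟩ := exists_subset_comp_mem_typeClass (m := m) hx
      exact ⟨J, by simp [Finset.mem_powersetCard, hJ, hj], h⟩)
  refine key.trans ?_
  have hcard : ((Finset.univ : Finset (Fin n)).powersetCard j).card = n.choose j := by simp
  rw [← hcard, ← nsmul_eq_mul]
  refine Finset.sum_le_card_nsmul _ _ _ ?_
  intro J hJ
  have hJc : J.card = j := (Finset.mem_powersetCard.1 hJ).2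
  have hJm : Jᶜ.card = m := by rw [Finset.card_compl, hJc]; simp; omega
  have hpow : ((Fintype.card V : ℝ) ^ j) = f.toFun (J → V) ⊥ := by
    rw [f.map_edgeless]; simp [hJc]
  rw [hpow, ← f.map_strongProd]
  refine f.mono_map (fun x => (fun i => x.1 i, ⟨x.1 ∘ Jᶜ.orderEmbOfFin hJm, x.2 hJm⟩)) ?_
  intro x y h
  simp only [adjOrEq_strongProd, adjOrEq_induce, adjOrEq_strongPow, adjOrEq_bot] at h ⊢
  intro i
  by_cases hi : i ∈ J
  · exact Or.inl (congrFun h.1 ⟨i, hi⟩)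
  · have hiJ : i ∈ Set.range (Jᶜ.orderEmbOfFin hJm) := by
      rw [Finset.range_orderEmbOfFin]; simpa using hi
    obtain ⟨k, rfl⟩ := hiJ
    exact h.2 k

/-- Union bound over the set of positions whose letter lies in `S`, whose size is fixed by the type;
outside it the letters are unconstrained. -/
theorem typeClass_le_pow_induce {n : ℕ} {t : V → ℕ} (S : Finset V) :
    f.toFun (typeClass n t) ((strongPow G n).induce (typeClass n t)) ≤
      2 ^ n * (f.toFun (S : Set V) (G.induce (S : Set V)) ^ (∑ v ∈ S, t v) *
        (Fintype.card V : ℝ) ^ (n - ∑ v ∈ S, t v)) := by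
  classical
  set k := ∑ v ∈ S, t v with hk
  have key := f.induce_biUnion_le (strongPow G n) ((Finset.univ : Finset (Fin n)).powersetCard k)
    (fun J => {x | ∀ i, x i ∈ if i ∈ J then (S : Set V) else Set.univ})
    (B := typeClass n t) (by
      intro x hx
      rw [mem_typeClass] at hx
      refine ⟨Finset.univ.filter fun i => x i ∈ S, ?_, ?_⟩
      · rw [Finset.mem_powersetCard_univ,
          Finset.card_eq_sum_card_fiberwise (f := x) (t := S) (by intro i; simp), hk]
        refine Finset.sum_congr rfl fun v hv => ?_
        rw [← hx v, Finset.filter_filter]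
        congr 1
        ext i
        simp only [Finset.mem_filter, Finset.mem_univ, true_and]
        exact ⟨fun h => h.2, fun h => ⟨h ▸ hv, h⟩⟩
      · intro i
        by_cases hi : x i ∈ S <;> simp [hi])
  refine key.trans ?_
  have hcard : (((Finset.univ : Finset (Fin n)).powersetCard k).card : ℝ) ≤ 2 ^ n := by
    simp only [Finset.card_powersetCard, Finset.card_univ, Fintype.card_fin]
    exact_mod_cast Nat.choose_le_two_pow n k
  refine le_trans ?_ (mul_le_mul_of_nonneg_right hcard
    (mul_nonneg (pow_nonneg (f.nonneg _ _) _) (by positivity)))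
  rw [← nsmul_eq_mul]
  refine Finset.sum_le_card_nsmul _ _ _ ?_
  intro J hJ
  have hJc : J.card = k := (Finset.mem_powersetCard.1 hJ).2
  refine (f.induce_pi_le G n _).trans ?_
  have hprod : (f.toFun (S : Set V) (G.induce (S : Set V)) ^ k *
      (Fintype.card V : ℝ) ^ (n - k)) =
      ∏ i : Fin n, if i ∈ J then f.toFun (S : Set V) (G.induce (S : Set V))
        else (Fintype.card V : ℝ) := by
    rw [Finset.prod_ite, Finset.prod_const, Finset.prod_const]
    congr 2
    · simp [hJc]
    · rw [Finset.filter_not, Finset.card_sdiff_of_subset (Finset.filter_subset _ _)]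
      simp [hJc]
  rw [hprod]
  refine Finset.prod_le_prod (fun i _ => f.nonneg _ _) fun i _ => ?_
  by_cases hi : i ∈ J
  · have hS : (if i ∈ J then (S : Set V) else Set.univ) ⊆ S := by rw [if_pos hi]
    exact (f.induce_mono G hS).trans (by rw [if_pos hi])
  · refine (f.le_card _).trans ?_
    rw [if_neg (c := i ∈ J) (t := f.toFun (S : Set V) (G.induce (S : Set V))) hi,
      ← Nat.card_eq_fintype_card]
    exact_mod_cast Finite.card_subtype_le _

end SpectralPoint

/-! ### Superadditivity and equicontinuity of log f on type classes. -/

section LogInduced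

variable (f : SpectralPoint.{u}) {V : Type u}

theorem one_le_induce [Finite V] (G : SimpleGraph V) {S : Set V} (hS : S.Nonempty) :
    1 ≤ f.toFun S (G.induce S) :=
  have := hS.to_subtype
  f.one_le _

theorem logInduced_nonneg [Finite V] (G : SimpleGraph V) {S : Set V} (hS : S.Nonempty) :
    0 ≤ logInduced f G S :=
  Real.logb_nonneg one_lt_two (one_le_induce f G hS)

variable [Fintype V] (G : SimpleGraph V)

theorem logInduced_typeClass_nonneg {n : ℕ} {t : V → ℕ} (h : ∑ v, t v = n) :
    0 ≤ logInduced f (strongPow G n) (typeClass n t) :=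
  logInduced_nonneg f _ (typeClass_nonempty h)

theorem logInduced_typeClass_add {m n k : ℕ} {s t : V → ℕ} (hs : ∑ v, s v = m)
    (ht : ∑ v, t v = n) (hk : m + n = k) :
    logInduced f (strongPow G m) (typeClass m s) + logInduced f (strongPow G n) (typeClass n t) ≤
      logInduced f (strongPow G k) (typeClass k (s + t)) := by
  have h1 := one_le_induce f (strongPow G m) (typeClass_nonempty hs)
  have h2 := one_le_induce f (strongPow G n) (typeClass_nonempty ht)
  unfold logInduced
  rw [← Real.logb_mul (by positivity) (by positivity)]
  exact Real.logb_le_logb_of_le one_lt_two (by positivity)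
    (f.induce_pow_le_mul G hk fun x hx y hy => append_mem_typeClass hk hx hy)

theorem logInduced_typeClass_mono {m k : ℕ} {s t : V → ℕ} (hs : ∑ v, s v = m)
    (ht : ∑ v, t v = k) (h : s ≤ t) :
    logInduced f (strongPow G m) (typeClass m s) ≤
      logInduced f (strongPow G k) (typeClass k t) := by
  have hadd : s + (t - s) = t := add_tsub_cancel_of_le h
  have hk : m + ∑ v, (t - s) v = k := by
    rw [← hs, ← Finset.sum_add_distrib, ← ht]
    exact Finset.sum_congr rfl fun v _ => congrFun hadd v
  have h1 := logInduced_typeClass_add f G hs (t := t - s) rfl hk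
  rw [hadd] at h1
  have h2 := logInduced_typeClass_nonneg f G (t := t - s) rfl
  linarith

theorem logInduced_typeClass_nsmul {m : ℕ} {s : V → ℕ} (hs : ∑ v, s v = m) (k : ℕ) :
    k * logInduced f (strongPow G m) (typeClass m s) ≤
      logInduced f (strongPow G (k * m)) (typeClass (k * m) (k • s)) := by
  induction k with
  | zero =>
    rw [Nat.cast_zero, zero_mul]
    exact logInduced_typeClass_nonneg f G (by simp)
  | succ k ih =>
    have h := logInduced_typeClass_add f G (s := k • s) (t := s) (m := k * m) (n := m)
      (k := (k + 1) * m) (by simp [← Finset.mul_sum, hs]) hs (by ring)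
    rw [← succ_nsmul] at h
    push_cast
    linarith

theorem logInduced_typeClass_le_card [Nonempty V] {n : ℕ} {t : V → ℕ} (h : ∑ v, t v = n) :
    logInduced f (strongPow G n) (typeClass n t) ≤ n * Real.logb 2 (Fintype.card V) := by
  rw [← Real.logb_pow]
  have h1 := one_le_induce f (strongPow G n) (typeClass_nonempty h)
  refine Real.logb_le_logb_of_le one_lt_two (by positivity) ((f.le_card _).trans ?_)
  have := Finite.card_subtype_le (fun x => x ∈ typeClass n t)
  have hc : Nat.card (Fin n → V) = Fintype.card V ^ n := by simp
  rw [hc] at this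
  exact_mod_cast this

/-- One term of the binomial expansion; with `x` free it replaces entropy estimates for binomial
coefficients. -/
theorem choose_mul_pow_le (n j : ℕ) {x : ℝ} (hx : 0 ≤ x) : n.choose j * x ^ j ≤ (1 + x) ^ n := by
  rcases le_or_gt j n with hj | hj
  · rw [add_comm, add_pow]
    have := Finset.single_le_sum (f := fun i => x ^ i * 1 ^ (n - i) * (n.choose i : ℝ))
      (s := Finset.range (n + 1)) (fun i _ => by positivity)
      (Finset.mem_range.2 (by omega : j < n + 1))
    simpa [mul_comm] using this
  · rw [Nat.choose_eq_zero_of_lt hj]; simp; positivity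

/-- Equicontinuity of the logarithmic rates of type classes: `x` bounds the entropy of the set of
positions that have to be changed. -/
theorem logInduced_typeClass_le_add [Nonempty V] {n : ℕ} {s t : V → ℕ} (hs : ∑ v, s v = n)
    (ht : ∑ v, t v = n) {x : ℝ} (hx : 0 < x) :
    logInduced f (strongPow G n) (typeClass n s) ≤
      logInduced f (strongPow G n) (typeClass n t) + n * Real.logb 2 (1 + x) +
        (∑ v, (s v - t v) : ℕ) * (Real.logb 2 (Fintype.card V) - Real.logb 2 x) := by
  -- Pass through the common part of the two types: removing `d` from `s` is costly, growing `w` to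
  -- `t` is free by monotonicity.
  set w : V → ℕ := s ⊓ t with hw
  set d : V → ℕ := s - t with hd
  have hwd : w + d = s := by
    ext v; simp only [hw, hd, Pi.add_apply, Pi.inf_apply, Pi.sub_apply]; omega
  have hdj : ∑ v, (s v - t v) = ∑ v, d v := rfl
  rw [hdj]
  set j := ∑ v, d v with hj
  have hn : ∑ v, w v + j = n := by
    rw [hj, ← Finset.sum_add_distrib, ← hs]
    exact Finset.sum_congr rfl fun v _ => congrFun hwd v
  have h1 := f.typeClass_add_le G (s := w) (d := d) rfl hn
  rw [hwd] at h1
  have h2 := logInduced_typeClass_mono f G (s := w) rfl ht inf_le_right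
  have hs1 := one_le_induce f (strongPow G n) (typeClass_nonempty hs)
  have hw1 := one_le_induce f (strongPow G (∑ v, w v)) (typeClass_nonempty (t := w) rfl)
  have hV : 0 < (Fintype.card V : ℝ) := by exact_mod_cast Fintype.card_pos
  have h3 : (n.choose j : ℝ) ≤ (1 + x) ^ n / x ^ j := by
    rw [le_div_iff₀ (by positivity)]; exact choose_mul_pow_le n j hx.le
  have h4 := h1.trans (mul_le_mul_of_nonneg_right h3 (by positivity))
  have h5 := Real.logb_le_logb_of_le one_lt_two (by positivity) h4
  rw [Real.logb_mul (by positivity) (by positivity), Real.logb_div (by positivity) (by positivity),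
    Real.logb_mul (by positivity) (by positivity), Real.logb_pow, Real.logb_pow,
    Real.logb_pow] at h5
  unfold logInduced at h2 ⊢
  linarith

end LogInduced

/-! ### Existence of the refinement and the lower bound for induced subgraphs. -/

section Convergence

variable (f : SpectralPoint.{u}) {V : Type u} [Fintype V] [Nonempty V] (G : SimpleGraph V)

/-- Round down and give the deficit, which is o(n), to one fixed letter. -/
theorem exists_types_tendsto {P : V → ℝ} (hP : P ∈ stdSimplex ℝ V) :
    ∃ t : ℕ → V → ℕ, (∀ n, ∑ v, t n v = n) ∧
      ∀ v, Tendsto (fun n : ℕ => (t n v : ℝ) / n) atTop (𝓝 (P v)) := by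
  classical
  let v₀ := Classical.arbitrary V
  have hfl : ∀ v, Tendsto (fun n : ℕ => (⌊P v * n⌋₊ : ℝ) / n) atTop (𝓝 (P v)) := fun v =>
    (tendsto_nat_floor_mul_div_atTop (hP.1 v)).comp tendsto_natCast_atTop_atTop
  have hle : ∀ n : ℕ, ∑ v, ⌊P v * n⌋₊ ≤ n := by
    intro n
    have h : ((∑ v, ⌊P v * n⌋₊ : ℕ) : ℝ) ≤ n := by
      push_cast
      calc ∑ v, (⌊P v * n⌋₊ : ℝ) ≤ ∑ v, P v * n :=
            Finset.sum_le_sum fun v _ => Nat.floor_le (mul_nonneg (hP.1 v) (Nat.cast_nonneg n))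
        _ = n := by rw [← Finset.sum_mul, hP.2, one_mul]
    exact_mod_cast h
  refine ⟨fun n v => ⌊P v * n⌋₊ + if v = v₀ then n - ∑ v, ⌊P v * n⌋₊ else 0, ?_, ?_⟩
  · intro n
    rw [Finset.sum_add_distrib]
    simp only [Finset.sum_ite_eq', Finset.mem_univ, if_true]
    have := hle n
    omega
  · have hrest : Tendsto (fun n : ℕ => ((n - ∑ v, ⌊P v * n⌋₊ : ℕ) : ℝ) / n) atTop (𝓝 0) := by
      have h : Tendsto (fun n : ℕ => 1 - ∑ v, (⌊P v * n⌋₊ : ℝ) / n) atTop (𝓝 (1 - ∑ v, P v)) :=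
        tendsto_const_nhds.sub (tendsto_finsetSum _ fun v _ => hfl v)
      rw [hP.2, sub_self] at h
      refine h.congr' ?_
      filter_upwards [eventually_gt_atTop 0] with n hn
      have : (n : ℝ) ≠ 0 := by positivity
      rw [Nat.cast_sub (hle n), sub_div, div_self this, ← Finset.sum_div]
      push_cast
      rfl
    intro v
    by_cases hv : v = v₀
    · simpa [hv, add_div] using (hfl v₀).add hrest
    · simpa [hv] using hfl v

theorem tendsto_natDiv_div {m : ℕ} :
    Tendsto (fun n : ℕ => ((n / m : ℕ) : ℝ) / n) atTop (𝓝 (1 / m : ℝ)) := by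
  have h := (tendsto_nat_floor_mul_div_atTop (R := ℝ) (a := 1 / (m : ℝ)) (by positivity)).comp
    tendsto_natCast_atTop_atTop
  refine h.congr fun n => ?_
  simp only [Function.comp_apply]
  rw [one_div_mul_eq_div, Nat.floor_div_eq_div]

/-- A Fekete-type argument: superadditivity along copies of `s m`, then equicontinuity to reach `t
n`. Two different sequences are allowed, so it also yields independence of the sequence. -/
theorem eventually_rate_ge {P : V → ℝ} {s t : ℕ → V → ℕ}
    (hs : ∀ n, ∑ v, s n v = n) (ht : ∀ n, ∑ v, t n v = n)
    (hsP : ∀ v, Tendsto (fun n : ℕ => (s n v : ℝ) / n) atTop (𝓝 (P v)))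
    (htP : ∀ v, Tendsto (fun n : ℕ => (t n v : ℝ) / n) atTop (𝓝 (P v))) {ε : ℝ} (hε : 0 < ε) :
    ∀ᶠ m : ℕ in atTop, ∀ᶠ n : ℕ in atTop,
      logInduced f (strongPow G m) (typeClass m (s m)) / m - ε ≤
        logInduced f (strongPow G n) (typeClass n (t n)) / n := by
  classical
  -- `x` is fixed before `m`: the constant `C` below may be large, but it multiplies a discrepancy
  -- of types that tends to 0.
  obtain ⟨x, hx, hx1⟩ : ∃ x : ℝ, 0 < x ∧ Real.logb 2 (1 + x) < ε / 2 := by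
    have h : Tendsto (fun x : ℝ => Real.logb 2 (1 + x)) (𝓝[>] 0) (𝓝 0) := by
      have : ContinuousAt (fun x : ℝ => Real.log (1 + x) / Real.log 2) 0 := by
        refine ContinuousAt.div_const (ContinuousAt.log (by fun_prop) (by norm_num)) _
      have h := this.tendsto
      simp only [add_zero, Real.log_one, zero_div] at h
      exact h.mono_left nhdsWithin_le_nhds
    obtain ⟨x, h1, h2⟩ := ((h.eventually_lt_const (half_pos hε)).and self_mem_nhdsWithin).exists
    exact ⟨x, h2, h1⟩
  set C := Real.logb 2 (Fintype.card V) - Real.logb 2 x with hC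
  let v₀ := Classical.arbitrary V
  have hD : Tendsto (fun m : ℕ => (∑ v, max ((s m v : ℝ) / m - P v) 0) * C) atTop (𝓝 0) := by
    have : Tendsto (fun m : ℕ => (∑ v, max ((s m v : ℝ) / m - P v) 0) * C) atTop
        (𝓝 ((∑ v : V, max (P v - P v) 0) * C)) :=
      (tendsto_finsetSum _ fun v _ =>
        ((hsP v).sub_const (P v)).max tendsto_const_nhds).mul_const C
    simpa using this
  filter_upwards [hD.eventually_lt_const (half_pos hε), eventually_gt_atTop 0] with m hm hm0
  -- As many copies of `s m` as fit, with the fewer than `m` remaining letters all equal to `v₀`.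
  let q : ℕ → V → ℕ := fun n => (n / m) • s m + fun v => if v = v₀ then n % m else 0
  have hq : ∀ n, ∑ v, q n v = n := by
    intro n
    simp only [q, Pi.add_apply, Pi.smul_apply, smul_eq_mul, Finset.sum_add_distrib,
      ← Finset.mul_sum, hs, Finset.sum_ite_eq', Finset.mem_univ, if_true]
    exact Nat.div_add_mod' n m
  have hmod : Tendsto (fun n : ℕ => ((n % m : ℕ) : ℝ) / n) atTop (𝓝 0) := by
    refine squeeze_zero (fun n => by positivity) (fun n => ?_)
      (tendsto_const_div_atTop_nhds_zero_nat (m : ℝ))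
    have : ((n % m : ℕ) : ℝ) ≤ m := by exact_mod_cast (Nat.mod_lt n hm0).le
    gcongr
  have hqP : ∀ v, Tendsto (fun n : ℕ => (q n v : ℝ) / n) atTop (𝓝 ((s m v : ℝ) / m)) := by
    intro v
    have h1 := (tendsto_natDiv_div (m := m)).mul_const (s m v : ℝ)
    rw [one_div_mul_eq_div] at h1
    have h2 : Tendsto (fun n : ℕ => ((if v = v₀ then n % m else 0 : ℕ) : ℝ) / n) atTop (𝓝 0) := by
      by_cases hv : v = v₀
      · simpa [hv] using hmod
      · simp [hv]
    have h3 := h1.add h2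
    rw [add_zero] at h3
    refine h3.congr fun n => ?_
    simp only [q, Pi.add_apply, Pi.smul_apply, smul_eq_mul]
    push_cast
    ring
  have hj : Tendsto (fun n : ℕ => ((∑ v, (q n v - t n v) : ℕ) : ℝ) / n * C) atTop
      (𝓝 ((∑ v, max ((s m v : ℝ) / m - P v) 0) * C)) := by
    have : Tendsto (fun n : ℕ => (∑ v, max ((q n v : ℝ) / n - (t n v : ℝ) / n) 0) * C) atTop
        (𝓝 ((∑ v, max ((s m v : ℝ) / m - P v) 0) * C)) :=
      (tendsto_finsetSum _ fun v _ => ((hqP v).sub (htP v)).max tendsto_const_nhds).mul_const C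
    -- Truncated subtraction in ℕ is the positive part of the real difference.
    refine this.congr fun n => ?_
    rw [Nat.cast_sum, Finset.sum_div]
    congr 1
    refine Finset.sum_congr rfl fun v _ => ?_
    rcases le_total (t n v) (q n v) with h | h
    · have h' : (t n v : ℝ) ≤ q n v := by exact_mod_cast h
      rw [Nat.cast_sub h, max_eq_left, sub_div]
      rw [← sub_div]
      exact div_nonneg (sub_nonneg.2 h') (Nat.cast_nonneg n)
    · have h' : (q n v : ℝ) ≤ t n v := by exact_mod_cast h
      rw [Nat.sub_eq_zero_of_le h, max_eq_right]
      · simp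
      · rw [← sub_div]
        exact div_nonpos_of_nonpos_of_nonneg (sub_nonpos.2 h') (Nat.cast_nonneg n)
  have hA : Tendsto (fun n : ℕ => ((n / m : ℕ) : ℝ) / n *
      logInduced f (strongPow G m) (typeClass m (s m)) - Real.logb 2 (1 + x) -
        ((∑ v, (q n v - t n v) : ℕ) : ℝ) / n * C) atTop
      (𝓝 (1 / m * logInduced f (strongPow G m) (typeClass m (s m)) - Real.logb 2 (1 + x) -
        (∑ v, max ((s m v : ℝ) / m - P v) 0) * C)) :=
    ((tendsto_natDiv_div.mul_const _).sub_const _).sub hj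
  have hlt : logInduced f (strongPow G m) (typeClass m (s m)) / m - ε <
      1 / m * logInduced f (strongPow G m) (typeClass m (s m)) - Real.logb 2 (1 + x) -
        (∑ v, max ((s m v : ℝ) / m - P v) 0) * C := by
    rw [one_div_mul_eq_div]; linarith
  filter_upwards [hA.eventually_const_lt hlt, eventually_gt_atTop 0] with n hn hn0
  refine hn.le.trans ?_
  have hnR : (0 : ℝ) < n := by exact_mod_cast hn0
  have h1 := logInduced_typeClass_nsmul f G (hs m) (n / m)
  have h2 := logInduced_typeClass_mono f G (s := (n / m) • s m) (m := n / m * m) (t := q n)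
    (by simp [← Finset.mul_sum, hs]) (hq n) (le_add_of_nonneg_right (fun v => Nat.zero_le _))
  have h3 := logInduced_typeClass_le_add f G (hq n) (ht n) hx
  have h4 := h1.trans (h2.trans h3)
  rw [le_div_iff₀ hnR]
  have e : (((n / m : ℕ) : ℝ) / n * logInduced f (strongPow G m) (typeClass m (s m)) -
      Real.logb 2 (1 + x) - ((∑ v, (q n v - t n v) : ℕ) : ℝ) / n * C) * n =
      ((n / m : ℕ) : ℝ) * logInduced f (strongPow G m) (typeClass m (s m)) -
      n * Real.logb 2 (1 + x) - ((∑ v, (q n v - t n v) : ℕ) : ℝ) * C := by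
    field_simp
  rw [e]
  linarith

theorem tendsto_of_eventually_sub_le {a : ℕ → ℝ} {B : ℝ} (h0 : ∀ n, 0 ≤ a n) (hB : ∀ n, a n ≤ B)
    (h : ∀ ε > 0, ∀ᶠ m in atTop, ∀ᶠ n in atTop, a m - ε ≤ a n) :
    ∃ L, Tendsto a atTop (𝓝 L) := by
  have hbdd : IsBoundedUnder (· ≤ ·) atTop a := isBoundedUnder_of ⟨B, hB⟩
  have hbdd' : IsBoundedUnder (· ≥ ·) atTop a := isBoundedUnder_of ⟨0, h0⟩
  refine ⟨_, tendsto_of_le_liminf_of_limsup_le ?_ le_rfl hbdd hbdd'⟩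
  refine le_of_forall_pos_le_add fun ε hε => ?_
  refine limsup_le_of_le hbdd'.isCoboundedUnder_le ?_
  filter_upwards [h ε hε] with m hm
  have := le_liminf_of_le hbdd.isCoboundedUnder_ge hm
  linarith

theorem exists_isLogRefinement {P : V → ℝ} (hP : P ∈ stdSimplex ℝ V) :
    ∃ L, IsLogRefinement f G P L := by
  obtain ⟨s, hs, hsP⟩ := exists_types_tendsto hP
  obtain ⟨L, hL⟩ := tendsto_of_eventually_sub_le
    (a := fun n => logInduced f (strongPow G n) (typeClass n (s n)) / n)
    (B := Real.logb 2 (Fintype.card V))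
    (fun n => div_nonneg (logInduced_typeClass_nonneg f G (hs n)) (Nat.cast_nonneg n))
    (fun n => div_le_of_le_mul₀ (Nat.cast_nonneg n)
      (Real.logb_nonneg one_lt_two (by exact_mod_cast Fintype.card_pos))
      ((logInduced_typeClass_le_card f G (hs n)).trans_eq (mul_comm _ _)))
    (fun ε hε => eventually_rate_ge f G hs hs hsP hsP hε)
  -- The lower bound compares `s` at a fixed length with `t` at large lengths; the upper bound swaps
  -- the two roles.
  refine ⟨L, fun t ht htP => ?_⟩
  rw [tendsto_order]
  constructor
  · intro b hb
    have hε : 0 < (L - b) / 2 := by linarith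
    obtain ⟨m, h1, h2⟩ := ((eventually_rate_ge f G hs ht hsP htP hε).and
      (hL.eventually_const_lt (show b + (L - b) / 2 < L by linarith))).exists
    filter_upwards [h1] with n hn
    linarith
  · intro b hb
    have hε : 0 < (b - L) / 2 := by linarith
    filter_upwards [eventually_rate_ge f G ht hs htP hsP hε] with m hm
    have := ge_of_tendsto hL hm
    linarith

theorem isLogRefinement_logRefinement {P : V → ℝ} (hP : P ∈ stdSimplex ℝ V) :
    IsLogRefinement f G P (logRefinement f G P) := by
  have h := exists_isLogRefinement f G hP
  rw [logRefinement, dif_pos h]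
  exact h.choose_spec

/-- The 1 is the rate of the factor 2^n counting position sets. The covering bound gives P(S)·log
f(G[S]), and P(S) can be dropped since log f(G[S]) ≥ 0. -/
theorem logRefinement_le_logInduced {P : V → ℝ} (hP : P ∈ stdSimplex ℝ V) {S : Finset V}
    (hS : S.Nonempty) :
    logRefinement f G P - (1 - ∑ v ∈ S, P v) * Real.logb 2 (Fintype.card V) - 1 ≤
      logInduced f G (S : Set V) := by
  obtain ⟨t, ht, htP⟩ := exists_types_tendsto hP
  have hlim := isLogRefinement_logRefinement f G hP t ht htP
  set A := logInduced f G (S : Set V) with hA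
  have hA0 : 0 ≤ A := logInduced_nonneg f G (by exact_mod_cast hS)
  have hsum : Tendsto (fun n : ℕ => ∑ v ∈ S, (t n v : ℝ) / n) atTop (𝓝 (∑ v ∈ S, P v)) :=
    tendsto_finsetSum _ fun v _ => htP v
  have hR := ((tendsto_const_nhds (x := (1 : ℝ))).add (hsum.mul_const A)).add
    ((hsum.const_sub 1).mul_const (Real.logb 2 (Fintype.card V)))
  have key : logRefinement f G P ≤ 1 + (∑ v ∈ S, P v) * A +
      (1 - ∑ v ∈ S, P v) * Real.logb 2 (Fintype.card V) := by
    refine le_of_tendsto_of_tendsto hlim hR ?_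
    filter_upwards [eventually_gt_atTop 0] with n hn
    have hnR : (0 : ℝ) < n := by exact_mod_cast hn
    have hV : 0 < (Fintype.card V : ℝ) := by exact_mod_cast Fintype.card_pos
    have h1 := one_le_induce f (strongPow G n) (typeClass_nonempty (ht n))
    have h2 := one_le_induce f G (S := (S : Set V)) (by exact_mod_cast hS)
    have hle : ∑ v ∈ S, t n v ≤ n := by
      conv_rhs => rw [← ht n]
      exact Finset.sum_le_sum_of_subset (Finset.subset_univ S)
    have h3 := Real.logb_le_logb_of_le one_lt_two (by positivity)
      (f.typeClass_le_pow_induce G (n := n) (t := t n) S)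
    rw [Real.logb_mul (by positivity) (by positivity),
      Real.logb_mul (by positivity) (by positivity), Real.logb_pow, Real.logb_pow,
      Real.logb_pow, Real.logb_self_eq_one one_lt_two, Nat.cast_sub hle] at h3
    rw [← Finset.sum_div, div_le_iff₀ hnR]
    have e : (1 + (∑ v ∈ S, (t n v : ℝ)) / n * A +
        (1 - (∑ v ∈ S, (t n v : ℝ)) / n) * Real.logb 2 (Fintype.card V)) * n =
        n * 1 + ((∑ v ∈ S, (t n v : ℝ)) * A +
          (n - ∑ v ∈ S, (t n v : ℝ)) * Real.logb 2 (Fintype.card V)) := by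
      field_simp
      ring
    rw [e]
    push_cast at h3
    exact h3
  have hle1 : ∑ v ∈ S, P v ≤ 1 := by
    rw [← hP.2]
    exact Finset.sum_le_sum_of_subset_of_nonneg (Finset.subset_univ S) fun v _ _ => hP.1 v
  have : (∑ v ∈ S, P v) * A ≤ A := mul_le_of_le_one_left hA0 hle1
  linarith

end Convergence

/-! ### The bound for measures on sequences. -/

section AEP

variable (f : SpectralPoint.{u}) {V : Type u} [Fintype V] [MeasurableSpace V]
  (G : SimpleGraph V) (μ : Measure (ℕ → V)) [IsProbabilityMeasure μ]

instance marginal.instIsProbabilityMeasure (n : ℕ) : IsProbabilityMeasure (marginal μ n) :=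
  Measure.isProbabilityMeasure_map
    (measurable_pi_lambda _ fun _ => measurable_pi_apply _).aemeasurable

variable [DiscreteMeasurableSpace V]

theorem marginal_mem_stdSimplex (n : ℕ) :
    (fun x => (marginal μ n).real {x}) ∈ stdSimplex ℝ (Fin n → V) := by
  refine ⟨fun _ => measureReal_nonneg, ?_⟩
  rw [sum_measureReal_singleton]
  simp

theorem logRefinement_marginal_le_minRate [Nonempty V] {c : ℝ} (hc : c ∈ Set.Ioo (0 : ℝ) 1) {n : ℕ}
    (hn : 0 < n) :
    logRefinement f (strongPow G n) (fun x => (marginal μ n).real {x}) / n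
      - (1 - c) * Real.logb 2 (Fintype.card V) - 1 / n ≤ minRate f G μ c n := by
  have hnR : (0 : ℝ) < n := by exact_mod_cast hn
  refine le_csInf (Set.Nonempty.image _ ⟨Set.univ, by simpa using hc.2.le⟩) ?_
  rintro _ ⟨S, hS, rfl⟩
  change c ≤ (marginal μ n).real S at hS
  obtain ⟨T, rfl⟩ : ∃ T : Finset (Fin n → V), (T : Set (Fin n → V)) = S :=
    ⟨S.toFinite.toFinset, by simp⟩
  -- Positivity of `c` rules out the empty set, to which the bound of part (1) does not apply.
  have hT : T.Nonempty := by
    rw [Finset.nonempty_iff_ne_empty]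
    rintro rfl
    simp only [Finset.coe_empty, measureReal_empty] at hS
    exact absurd hc.1 (not_lt.2 hS)
  have h := logRefinement_le_logInduced f (strongPow G n) (marginal_mem_stdSimplex μ n) hT
  rw [sum_measureReal_singleton, Fintype.card_fun, Fintype.card_fin, Nat.cast_pow,
    Real.logb_pow] at h
  have hlog : 0 ≤ Real.logb 2 (Fintype.card V) :=
    Real.logb_nonneg one_lt_two (by exact_mod_cast Fintype.card_pos)
  have h2 : (1 - (marginal μ n).real T) * (n * Real.logb 2 (Fintype.card V)) ≤
      (1 - c) * (n * Real.logb 2 (Fintype.card V)) :=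
    mul_le_mul_of_nonneg_right (by linarith) (by positivity)
  rw [le_div_iff₀ hnR]
  have e : (logRefinement f (strongPow G n) (fun x => (marginal μ n).real {x}) / n
      - (1 - c) * Real.logb 2 (Fintype.card V) - 1 / n) * n =
      logRefinement f (strongPow G n) (fun x => (marginal μ n).real {x})
      - (1 - c) * (n * Real.logb 2 (Fintype.card V)) - 1 := by
    field_simp
  rw [e]
  linarith

theorem limsup_logRefinement_marginal_le {L : ℝ} (hL : IsCommonLimit f G μ L) :
    limsup (fun n : ℕ =>
      ((logRefinement f (strongPow G n) (fun x => (marginal μ n).real {x}) / n : ℝ) : EReal))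
        atTop ≤ (L : EReal) := by
  have : Nonempty V := (nonempty_of_isProbabilityMeasure μ).map fun ω => ω 0
  rw [← EReal.le_of_forall_lt_iff_le]
  intro z hz
  have hz' : L < z := by exact_mod_cast hz
  -- The common limit does not depend on `c`, so `c` may be taken so close to 1 that the error fits
  -- below `z`.
  obtain ⟨c, hcz, hc⟩ : ∃ c : ℝ, L + (1 - c) * Real.logb 2 (Fintype.card V) < z ∧
      c ∈ Set.Ioo (0 : ℝ) 1 := by
    have h : Tendsto (fun c : ℝ => L + (1 - c) * Real.logb 2 (Fintype.card V)) (𝓝[<] 1)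
        (𝓝 (L + (1 - 1) * Real.logb 2 (Fintype.card V))) :=
      (Continuous.tendsto (by fun_prop) 1).mono_left nhdsWithin_le_nhds
    rw [sub_self, zero_mul, add_zero] at h
    exact ((h.eventually_lt_const hz').and (Ioo_mem_nhdsLT one_pos)).exists
  have hlim : Tendsto (fun n : ℕ =>
      minRate f G μ c n + (1 - c) * Real.logb 2 (Fintype.card V) + 1 / (n : ℝ)) atTop
      (𝓝 (L + (1 - c) * Real.logb 2 (Fintype.card V) + 0)) :=
    ((hL c hc).add_const _).add tendsto_one_div_atTop_nhds_zero_nat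
  rw [add_zero] at hlim
  refine limsup_le_of_le (by isBoundedDefault) ?_
  filter_upwards [hlim.eventually_lt_const hcz, eventually_gt_atTop 0] with n hn hn0
  have := logRefinement_marginal_le_minRate f G μ hc hn0
  exact_mod_cast (by linarith : logRefinement f (strongPow G n)
    (fun x => (marginal μ n).real {x}) / n ≤ z)

end AEP
end AmbiguousAEP

theorem mainTheorem11 {V : Type u} [Fintype V] (G : SimpleGraph V) :
    (∀ (f : AmbiguousAEP.SpectralPoint.{u}) (P : V → ℝ), P ∈ stdSimplex ℝ V →
      AmbiguousAEP.IsLogRefinement f G P (AmbiguousAEP.logRefinement f G P) ∧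
      ∀ S : Finset V, S.Nonempty →
        AmbiguousAEP.logRefinement f G P
            - (1 - ∑ v ∈ S, P v) * Real.logb 2 (Fintype.card V) - 1
          ≤ AmbiguousAEP.logInduced f G (S : Set V)) ∧
    (∀ [MeasurableSpace V] [DiscreteMeasurableSpace V] (μ : Measure (ℕ → V))
      [IsProbabilityMeasure μ], AmbiguousAEP.HasAEP G μ →
      ∀ f : AmbiguousAEP.SpectralPoint.{u}, ∃ L : ℝ, AmbiguousAEP.IsCommonLimit f G μ L ∧
        limsup (fun n : ℕ =>
          ((AmbiguousAEP.logRefinement f (AmbiguousAEP.strongPow G n)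
            (fun x => (AmbiguousAEP.marginal μ n).real {x}) / n : ℝ) : EReal)) atTop
          ≤ (L : EReal)) := by
  refine ⟨fun f P hP => ?_, fun μ _ hμ f => ?_⟩
  · have : Nonempty V := by
      by_contra h
      rw [not_nonempty_iff] at h
      simpa using hP.2
    exact ⟨AmbiguousAEP.isLogRefinement_logRefinement f G hP,
      fun S hS => AmbiguousAEP.logRefinement_le_logInduced f G hP hS⟩
  · obtain ⟨L, hL⟩ := hμ f
    exact ⟨L, hL, AmbiguousAEP.limsup_logRefinement_marginal_le f G μ hL⟩
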